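/- Let $A$ be an artin algebra and $n\ge 2$. For integers $a\le b$ let $\mathbf{C}_{[a,b]}(\mathrm{proj}\,A)$ be the full subcategory of cochain complexes $X=(X^i,d^i)_{i\in\mathbb Z}$ of $A$-modules with every $X^i$ finitely generated projective and $X^i=0$ for $i\notin[a,b]$; put $\mathbf{C}_n(\mathrm{proj}\,A)=\mathbf{C}_{[1,n]}(\mathrm{proj}\,A)$. Let $F:\mathbf{C}_{[0,n]}(\mathrm{proj}\,A)\to\mathbf{C}_n(\mathrm{proj}\,A)$ and $G:\mathbf{C}_{[0,n]}(\mathrm{proj}\,A)\to\mathbf{C}_{[0,n-1]}(\mathrm{proj}\,A)$ be the hard truncation functors, which delete the entry in degree $0$, respectively in degree $n$. A morphism $f$ is irreducible if it is neither a section nor a retraction and, whenever $f=hg$, either $g$ is a section or $h$ is a retraction. The radical of these categories is the ideal generated by the non-isomorphisms between indecomposable objects, and a morphism is radical-irreducible if it is irreducible and lies in the radical. If $W$ is an indecomposable complex in $\mathbf{C}_n(\mathrm{proj}\,A)$, a left enlargement of $W$ is an indecomposable complex $Z$ in $\mathbf{C}_{[0,n]}(\mathrm{proj}\,A)$ such that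 $Z^0\ne0$ and $W$ is a direct summand of $F(Z)$. A stalk injective complex is a complex in $\mathbf{C}_{[0,n]}(\mathrm{proj}\,A)$ with exactly one nonzero entry which is an injective object for the exact structure given by the degreewise split short exact sequences. **Proposition.** Let $X$ and $Y$ be indecomposable complexes in $\mathbf{C}_{[0,n]}(\mathrm{proj}\,A)$ with $X^0\neq0$ and $Y^0\neq0$, and let $f:X\to Y$ be an irreducible morphism in $\mathbf{C}_{[0,n]}(\mathrm{proj}\,A)$. (a) If neither $X$ nor $Y$ is a stalk injective complex, then at least one of the following holds: there is an indecomposable complex $W$ in $\mathbf{C}_n(\mathrm{proj}\,A)$ such that $X$ and $Y$ are two non-isomorphic left enlargements of $W$; or $F(f)$ is radical-irreducible in $\mathbf{C}_n(\mathrm{proj}\,A)$ and $f^0:X^0\to Y^0$ is a retraction. (b) If $X$ or $Y$ is a stalk injective complex, then $G(f)$ is an irreducible morphism in $\mathbf{C}_{[0,n-1]}(\mathrm{proj}\,A)$. -/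

import Mathlib

open CategoryTheory CategoryTheory.Limits

universe u w

section General

variable {C : Type*} [Category* C]

/-- `f` is irreducible if it is neither a section nor a retraction and, for every factorization
`f = h ∘ g`, either `g` is a section or `h` is a retraction. -/
def IsIrreducibleHom {X Y : C} (f : X ⟶ Y) : Prop :=
  ¬ IsSplitMono f ∧ ¬ IsSplitEpi f ∧
    ∀ ⦃Z : C⦄ (g : X ⟶ Z) (h : Z ⟶ Y), g ≫ h = f → IsSplitMono g ∨ IsSplitEpi h

variable [Preadditive C] [HasBinaryBiproducts C]

/-- `W` is a direct summand of `X`: there is a complement `W'` with `X ≅ W ⊕ W'`. -/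
def IsDirectSummand (W X : C) : Prop :=
  ∃ W' : C, Nonempty (X ≅ W ⊞ W')

/-- The Jacobson radical `ℜ(X, Y)` of a (Krull-Schmidt) category: the ideal generated by the
non-isomorphisms between indecomposable objects. Its elements are the finite sums of morphisms
`X ⟶ Z ⟶ W ⟶ Y` whose middle factor is a non-isomorphism between indecomposable objects. -/
def radicalHom (X Y : C) : AddSubgroup (X ⟶ Y) :=
  AddSubgroup.closure {f | ∃ (Z W : C) (a : X ⟶ Z) (g : Z ⟶ W) (b : W ⟶ Y),
    Indecomposable Z ∧ Indecomposable W ∧ ¬ IsIso g ∧ a ≫ g ≫ b = f}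

/-- A radical-irreducible morphism: a morphism in the radical which is also irreducible. -/
def IsRadicalIrreducible {X Y : C} (f : X ⟶ Y) : Prop :=
  f ∈ radicalHom X Y ∧ IsIrreducibleHom f

end General

section Complexes

variable (A : Type u) [Ring A]

/-- The property of a cochain complex `X` of `A`-modules of lying in `C_[m,n](proj A)`: every `X^i`
is a finitely generated projective module, and `X^i = 0` for `i ∉ [m, n]`. -/
def isFixedSizeProj (m n : ℤ) : ObjectProperty (CochainComplex (ModuleCat.{u} A) ℤ) := fun X ↦
  (∀ i, Module.Finite A (X.X i) ∧ Module.Projective A (X.X i)) ∧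
    ∀ i, i ∉ Set.Icc m n → IsZero (X.X i)

/-- The category `C_[m,n](proj A)` of complexes of fixed size, a full subcategory of the category
of cochain complexes of `A`-modules. -/
abbrev FixedSize (m n : ℤ) : Type _ := (isFixedSizeProj A m n).FullSubcategory

variable {A}

theorem isFixedSizeProj_biprod {m n : ℤ} {K L : CochainComplex (ModuleCat.{u} A) ℤ}
    (hK : isFixedSizeProj A m n K) (hL : isFixedSizeProj A m n L) :
    isFixedSizeProj A m n (K ⊞ L) := by
  have e (i : ℤ) : (K ⊞ L).X i ≅ ModuleCat.of A (K.X i × L.X i) :=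
    HomologicalComplex.biprodXIso K L i ≪≫ ModuleCat.biprodIsoProd _ _
  refine ⟨fun i ↦ ?_, fun i hi ↦ ?_⟩
  · have h1 := hK.1 i
    have h2 := hL.1 i
    have := h1.1
    have := h1.2
    have := h2.1
    have := h2.2
    exact ⟨Module.Finite.equiv (e i).symm.toLinearEquiv,
      Module.Projective.of_equiv (e i).symm.toLinearEquiv⟩
  · have h1 := ModuleCat.subsingleton_of_isZero (hK.2 i hi)
    have h2 := ModuleCat.subsingleton_of_isZero (hL.2 i hi)
    exact (ModuleCat.isZero_of_subsingleton (ModuleCat.of A (K.X i × L.X i))).of_iso (e i)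

instance instHasBinaryBiproductsFixedSize (m n : ℤ) : HasBinaryBiproducts (FixedSize A m n) where
  has_binary_biproduct X Y := by
    let P := isFixedSizeProj A m n
    exact HasBinaryBiproduct.mk
      { bicone :=
          { pt := ⟨X.obj ⊞ Y.obj, isFixedSizeProj_biprod X.property Y.property⟩
            fst := P.homMk biprod.fst
            snd := P.homMk biprod.snd
            inl := P.homMk biprod.inl
            inr := P.homMk biprod.inr }
        isBilimit := isBinaryBilimitOfTotal _ (by
          ext1
          exact biprod.total) }

theorem isFixedSizeProj_stupidTrunc {ι : Type*} {c : ComplexShape ι}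
    (e : c.Embedding (ComplexShape.up ℤ)) [e.IsRelIff] {m n a b : ℤ}
    (he : ∀ j : ι, e.f j ∈ Set.Icc m n → e.f j ∈ Set.Icc a b)
    {K : CochainComplex (ModuleCat.{u} A) ℤ} (hK : isFixedSizeProj A m n K) :
    isFixedSizeProj A a b (K.stupidTrunc e) := by
  refine ⟨fun i ↦ ?_, fun i hi ↦ ?_⟩
  · by_cases h : ∃ j, e.f j = i
    · obtain ⟨j, hj⟩ := h
      have := (hK.1 i).1
      have := (hK.1 i).2
      exact ⟨Module.Finite.equiv (K.stupidTruncXIso e hj).symm.toLinearEquiv,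
        Module.Projective.of_equiv (K.stupidTruncXIso e hj).symm.toLinearEquiv⟩
    · have := ModuleCat.subsingleton_of_isZero
        (K.isZero_stupidTrunc_X e i (fun j hj ↦ h ⟨j, hj⟩))
      exact ⟨inferInstance, inferInstance⟩
  · by_cases h : ∃ j, e.f j = i
    · obtain ⟨j, rfl⟩ := h
      exact (hK.2 _ (fun h' ↦ hi (he j h'))).of_iso (K.stupidTruncXIso e rfl)
    · exact K.isZero_stupidTrunc_X e i (fun j hj ↦ h ⟨j, hj⟩)

/-- The left hard truncation `C_[m,n](proj A) ⥤ C_[a,n](proj A)`, which keeps the entries and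
differentials in degrees `≥ a` and puts `0` in degrees `< a`. -/
noncomputable def truncGEFunctor (m n a : ℤ) : FixedSize A m n ⥤ FixedSize A a n :=
  (isFixedSizeProj A a n).lift
    ((isFixedSizeProj A m n).ι ⋙
      (ComplexShape.embeddingUpIntGE a).stupidTruncFunctor (ModuleCat.{u} A))
    (fun X ↦ isFixedSizeProj_stupidTrunc (ComplexShape.embeddingUpIntGE a)
      (fun j hj ↦ ⟨by change a ≤ a + (j : ℤ); omega, hj.2⟩) X.property)

/-- The right hard truncation `C_[m,n](proj A) ⥤ C_[m,b](proj A)`, which keeps the entries and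
differentials in degrees `≤ b` and puts `0` in degrees `> b`. -/
noncomputable def truncLEFunctor (m n b : ℤ) : FixedSize A m n ⥤ FixedSize A m b :=
  (isFixedSizeProj A m b).lift
    ((isFixedSizeProj A m n).ι ⋙
      (ComplexShape.embeddingUpIntLE b).stupidTruncFunctor (ModuleCat.{u} A))
    (fun X ↦ isFixedSizeProj_stupidTrunc (ComplexShape.embeddingUpIntLE b)
      (fun j hj ↦ ⟨hj.1, by change b - (j : ℤ) ≤ b; omega⟩) X.property)

/-- The functor `F : C_[0,n](proj A) ⥤ C_n(proj A) = C_[1,n](proj A)`. -/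
noncomputable abbrev functorF (n : ℤ) : FixedSize A 0 n ⥤ FixedSize A 1 n :=
  truncGEFunctor 0 n 1

/-- The functor `G : C_[0,n](proj A) ⥤ C_[0,n-1](proj A)`. -/
noncomputable abbrev functorG (n : ℤ) : FixedSize A 0 n ⥤ FixedSize A 0 (n - 1) :=
  truncLEFunctor 0 n (n - 1)

/-- `Z` is a left enlargement of the indecomposable complex `X` of `C_n(proj A)`: `Z` is an
indecomposable complex of `C_[0,n](proj A)`, `Z^0 ≠ 0`, and `X` is a direct summand of `F(Z)`. -/
def IsLeftEnlargement {n : ℤ} (X : FixedSize A 1 n) (Z : FixedSize A 0 n) : Prop :=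
  Indecomposable X ∧ Indecomposable Z ∧ ¬ IsZero (Z.obj.X 0) ∧
    IsDirectSummand X ((functorF n).obj Z)

/-- A stalk complex: exactly one entry is nonzero. -/
def IsStalk {m n : ℤ} (X : FixedSize A m n) : Prop :=
  ∃ i, ¬ IsZero (X.obj.X i) ∧ ∀ j, j ≠ i → IsZero (X.obj.X j)

/-- Injective objects of `C_[m,n](proj A)` for its exact structure, whose conflations are the
degreewise split short exact sequences: every morphism into `I` extends along every degreewise
split monomorphism. -/
def IsInjectiveComplex {m n : ℤ} (I : FixedSize A m n) : Prop :=
  ∀ ⦃U V : FixedSize A m n⦄ (s : U ⟶ V), (∀ i, IsSplitMono (s.hom.f i)) →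
    ∀ g : U ⟶ I, ∃ h : V ⟶ I, s ≫ h = g

/-- A stalk injective complex: a stalk complex which is injective in `C_[m,n](proj A)`. -/
def IsStalkInjective {m n : ℤ} (X : FixedSize A m n) : Prop :=
  IsStalk X ∧ IsInjectiveComplex X

end Complexes

/-! ### Retracts, indecomposable decompositions and the radical in preadditive categories. -/

section Retracts

variable {C : Type*} [Category* C] [Preadditive C]

/-! Factorizations of a truncated morphism lift to the morphism itself. If `F(f) = h g` through `Z`,
the pushout of `F(X) → X` along `g` is `X` in degree 0 and `Z` in degrees at least 1, and `f`
factors through it. By irreducibility either `g` is a section, or `h` and `f^0` are both retractions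
(`exists_factorization_of_truncGE`). Pullbacks give the dual for `G`
(`exists_factorization_of_truncLE`).

For (a), the factorization `F(f) = 𝟙 F(f)` shows that `F(f)` is a section or `f^0` is a retraction.
If `F(f)` splits or lies outside the radical, then `F(X)` and `F(Y)` share an indecomposable
summand; otherwise `F(f)` is radical-irreducible and `f^0` is a retraction. An isomorphism `X ≅ Y`
would turn `f` into a non-invertible endomorphism of `X`, nilpotent by Fitting, yet monic after `F`
or epic in degree 0: then `F(X) = 0` or `X^0 = 0`. The first is excluded because a complex
concentrated in degree 0 is stalk injective.

For (b), the lifted factorizations leave only splitness to check: a splitting of `G(f)` forces the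
relevant complex to be concentrated in degree 0, and then the splitting lifts to `f`. -/

theorem exists_complement_of_retract [IsIdempotentComplete C] {X W : C} (i : W ⟶ X) (r : X ⟶ W)
    (h : i ≫ r = 𝟙 W) :
    ∃ (W' : C) (k : W' ⟶ X) (q : X ⟶ W'),
      k ≫ q = 𝟙 W' ∧ i ≫ q = 0 ∧ k ≫ r = 0 ∧ r ≫ i + q ≫ k = 𝟙 X := by
  obtain ⟨W', k, q, hkq, hqk⟩ := IsIdempotentComplete.idempotents_split X (𝟙 X - r ≫ i)
    (by simp [reassoc_of% h])
  refine ⟨W', k, q, hkq, ?_, ?_, by simp [hqk]⟩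
  · rw [← Category.comp_id q, ← hkq, reassoc_of% hqk]
    simp [reassoc_of% h]
  · rw [← Category.id_comp k, ← hkq, Category.assoc, Category.assoc, reassoc_of% hqk]
    simp [h]

variable [HasBinaryBiproducts C]

/-- The decomposition of an object given by two complementary retracts. -/
noncomputable def isoBiprodOfComplementary {X W W' : C} {i : W ⟶ X} {r : X ⟶ W} {k : W' ⟶ X}
    {q : X ⟶ W'} (hir : i ≫ r = 𝟙 W) (hkq : k ≫ q = 𝟙 W') (hiq : i ≫ q = 0) (hkr : k ≫ r = 0)
    (h : r ≫ i + q ≫ k = 𝟙 X) : X ≅ W ⊞ W' where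
  hom := biprod.lift r q
  inv := biprod.desc i k
  hom_inv_id := by simpa using h
  inv_hom_id := by ext <;> simp [hir, hkq, hiq, hkr]

theorem isDirectSummand_of_retract [IsIdempotentComplete C] {X W : C} (i : W ⟶ X) (r : X ⟶ W)
    (h : i ≫ r = 𝟙 W) : IsDirectSummand W X := by
  obtain ⟨W', k, q, hkq, hiq, hkr, ht⟩ := exists_complement_of_retract i r h
  exact ⟨W', ⟨isoBiprodOfComplementary h hkq hiq hkr ht⟩⟩

/-- The images of `e` and `𝟙 - e` are complementary summands, so one of them vanishes. -/
theorem eq_zero_or_eq_id_of_indecomposable [IsIdempotentComplete C] {X : C}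
    (hX : Indecomposable X) (e : X ⟶ X) (he : e ≫ e = e) : e = 0 ∨ e = 𝟙 X := by
  obtain ⟨W, i, r, hir, rfl⟩ := IsIdempotentComplete.idempotents_split X e he
  obtain ⟨W', k, q, hkq, hiq, hkr, ht⟩ := exists_complement_of_retract i r hir
  rcases hX.2 _ _ (isoBiprodOfComplementary hir hkq hiq hkr ht) with h | h
  · left
    simp [h.eq_of_tgt r 0]
  · right
    simpa [h.eq_of_tgt q 0] using ht

/-- The idempotent endomorphisms of `X` whose image is an indecomposable direct summand. -/
def indecomposableIdempotents (X : C) : Set (X ⟶ X) :=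
  {e | ∃ (Z : C) (a : X ⟶ Z) (b : Z ⟶ X), Indecomposable Z ∧ b ≫ a = 𝟙 Z ∧ a ≫ b = e}

/-- Objects with an additive size in `ℕ`, positive on nonzero objects, have a decomposition into
indecomposables. -/
theorem id_mem_closure_indecomposableIdempotents (size : C → ℕ)
    (hpos : ∀ X, ¬ IsZero X → 0 < size X)
    (hadd : ∀ X Y Z : C, (X ≅ Y ⊞ Z) → size X = size Y + size Z) (X : C) :
    𝟙 X ∈ AddSubgroup.closure (indecomposableIdempotents X) := by
  induction hs : size X using Nat.strong_induction_on generalizing X with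
  | _ s ih =>
    subst hs
    by_cases h0 : IsZero X
    · rw [h0.eq_of_src (𝟙 X) 0]
      exact zero_mem _
    by_cases hX : Indecomposable X
    · exact AddSubgroup.subset_closure ⟨X, 𝟙 X, 𝟙 X, hX, by simp, by simp⟩
    have hX' : ∃ Y Z, ∃ _ : X ≅ Y ⊞ Z, ¬ IsZero Y ∧ ¬ IsZero Z := by
      by_contra! hc
      exact hX ⟨h0, fun Y Z e ↦ or_iff_not_imp_left.2 (hc Y Z e)⟩
    obtain ⟨Y, Z, e, hY, hZ⟩ := hX'
    -- Conjugation by `p` and `i` carries indecomposable idempotents of a smaller retract `T` to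
    -- those of `X`, and sends `𝟙 T` to `p ≫ i`.
    have key : ∀ (T : C) (i : T ⟶ X) (p : X ⟶ T), i ≫ p = 𝟙 T → size T < size X →
        p ≫ i ∈ AddSubgroup.closure (indecomposableIdempotents X) := by
      intro T i p hip hT
      have hmem := ih _ hT T rfl
      have hle : AddSubgroup.closure (indecomposableIdempotents T) ≤
          (AddSubgroup.closure (indecomposableIdempotents X)).comap
            ((Preadditive.leftComp X p).comp (Preadditive.rightComp T i)) := by
        rw [AddSubgroup.closure_le]
        rintro _ ⟨U, a, b, hU, hba, rfl⟩
        refine AddSubgroup.subset_closure ⟨U, p ≫ a, b ≫ i, hU, ?_, ?_⟩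
        · simp [reassoc_of% hip, hba]
        · simp [Preadditive.leftComp, Preadditive.rightComp]
      simpa [Preadditive.leftComp, Preadditive.rightComp] using hle hmem
    have h1 := hpos Y hY
    have h2 := hpos Z hZ
    have h3 := hadd X Y Z e
    have hid : 𝟙 X = (e.hom ≫ biprod.fst) ≫ (biprod.inl ≫ e.inv) +
        (e.hom ≫ biprod.snd) ≫ (biprod.inr ≫ e.inv) := by
      calc 𝟙 X = e.hom ≫ (biprod.fst ≫ biprod.inl + biprod.snd ≫ biprod.inr) ≫ e.inv := by
            rw [biprod.total, Category.id_comp, e.hom_inv_id]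
        _ = _ := by
            simp only [Preadditive.add_comp, Preadditive.comp_add, Category.assoc]
    rw [hid]
    exact add_mem (key Y _ _ (by simp) (by omega)) (key Z _ _ (by simp) (by omega))

theorem exists_indecomposable_retract {X : C} (hX : ¬ IsZero X)
    (h : 𝟙 X ∈ AddSubgroup.closure (indecomposableIdempotents X)) :
    ∃ (W : C) (i : W ⟶ X) (r : X ⟶ W), Indecomposable W ∧ i ≫ r = 𝟙 W := by
  by_contra! hc
  have : indecomposableIdempotents X = ∅ := by
    rw [Set.eq_empty_iff_forall_notMem]
    rintro _ ⟨Z, a, b, hZ, hba, rfl⟩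
    exact hc Z b a hZ hba
  rw [this, AddSubgroup.closure_empty, AddSubgroup.mem_bot] at h
  exact hX ((IsZero.iff_id_eq_zero X).2 h)

/-- A morphism outside the radical has an isomorphism between indecomposable summands as one of its
components. -/
theorem exists_isIso_component_of_notMem_radicalHom {X Y : C} (φ : X ⟶ Y)
    (hX : 𝟙 X ∈ AddSubgroup.closure (indecomposableIdempotents X))
    (hY : 𝟙 Y ∈ AddSubgroup.closure (indecomposableIdempotents Y))
    (hφ : φ ∉ radicalHom X Y) :
    ∃ (Z W : C) (a : X ⟶ Z) (b : Z ⟶ X) (a' : Y ⟶ W) (b' : W ⟶ Y), Indecomposable Z ∧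
      Indecomposable W ∧ b ≫ a = 𝟙 Z ∧ b' ≫ a' = 𝟙 W ∧ IsIso (b ≫ φ ≫ a') := by
  by_contra! hc
  apply hφ
  -- Write `φ = 𝟙 ≫ φ ≫ 𝟙` and expand both identities into indecomposable idempotents: every term
  -- factors through a component, none of which is invertible.
  have h1 : ∀ e ∈ indecomposableIdempotents X,
      AddSubgroup.closure (indecomposableIdempotents Y) ≤
        (radicalHom X Y).comap (Preadditive.leftComp Y (e ≫ φ)) := by
    rintro _ ⟨Z, a, b, hZ, hba, rfl⟩
    rw [AddSubgroup.closure_le]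
    rintro _ ⟨W, a', b', hW, hba', rfl⟩
    exact AddSubgroup.subset_closure
      ⟨Z, W, a, b ≫ φ ≫ a', b', hZ, hW, hc Z W a b a' b' hZ hW hba hba',
        by simp [Preadditive.leftComp]⟩
  have h2 : AddSubgroup.closure (indecomposableIdempotents X) ≤
      (radicalHom X Y).comap (Preadditive.rightComp X φ) := by
    rw [AddSubgroup.closure_le]
    intro e he
    simpa [Preadditive.leftComp, Preadditive.rightComp] using h1 e he hY
  simpa [Preadditive.rightComp] using h2 hX

end Retracts

/-! ### Nilpotent endomorphisms, degreewise lifting and hard truncations. -/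

theorem isZero_of_mono_of_pow_eq_zero {C : Type*} [Category* C] [HasZeroMorphisms C] {X : C}
    (θ : End X) (hm : Mono (show X ⟶ X from θ)) (N : ℕ) (h : θ ^ N = (0 : X ⟶ X)) : IsZero X := by
  have : ∀ k : ℕ, Mono (show X ⟶ X from θ ^ k) := by
    intro k
    induction k with
    | zero => exact inferInstanceAs (Mono (𝟙 X))
    | succ k ih =>
      rw [pow_succ]
      exact mono_comp (show X ⟶ X from θ) (show X ⟶ X from θ ^ k)
  have := this N
  rw [IsZero.iff_id_eq_zero, ← cancel_mono (show X ⟶ X from θ ^ N)]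
  simp [h]

theorem isZero_of_epi_of_pow_eq_zero {C : Type*} [Category* C] [HasZeroMorphisms C] {X : C}
    (θ : End X) (hm : Epi (show X ⟶ X from θ)) (N : ℕ) (h : θ ^ N = (0 : X ⟶ X)) : IsZero X := by
  have : ∀ k : ℕ, Epi (show X ⟶ X from θ ^ k) := by
    intro k
    induction k with
    | zero => exact inferInstanceAs (Epi (𝟙 X))
    | succ k ih =>
      rw [pow_succ]
      exact epi_comp (show X ⟶ X from θ) (show X ⟶ X from θ ^ k)
  have := this N
  rw [IsZero.iff_id_eq_zero, ← cancel_epi (show X ⟶ X from θ ^ N)]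
  simp [h]

namespace HomologicalComplex

variable {V : Type*} [Category* V] [HasZeroMorphisms V] {ι : Type*} {c : ComplexShape ι}

/-- Commutation with the differentials can be tested after composing with a monic `s.f j`, and is
automatic where `T` vanishes. The second alternative permits `s` to fail to be monic in degrees that
no nonzero entry of `T` maps to. -/
theorem exists_lift_of_degreewise {T S K : HomologicalComplex V c} (φ : T ⟶ K) (s : S ⟶ K)
    (h : ∀ i, ∃ ψ, ψ ≫ s.f i = φ.f i)
    (hm : ∀ i j, c.Rel i j → IsZero (T.X i) ∨ Mono (s.f j)) : ∃ ψ : T ⟶ S, ψ ≫ s = φ := by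
  choose ψ hψ using h
  refine ⟨{ f := ψ, comm' := fun i j hij ↦ ?_ }, by ext i; exact hψ i⟩
  rcases hm i j hij with h | h
  · exact h.eq_of_src _ _
  · rw [← cancel_mono (s.f j), Category.assoc, ← s.comm, reassoc_of% hψ i, Category.assoc, hψ j,
      φ.comm]

theorem exists_desc_of_degreewise {T S K : HomologicalComplex V c} (φ : T ⟶ S) (p : T ⟶ K)
    (h : ∀ i, ∃ ψ, p.f i ≫ ψ = φ.f i)
    (hm : ∀ i j, c.Rel i j → IsZero (S.X j) ∨ Epi (p.f i)) : ∃ ψ : K ⟶ S, p ≫ ψ = φ := by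
  choose ψ hψ using h
  refine ⟨{ f := ψ, comm' := fun i j hij ↦ ?_ }, by ext i; exact hψ i⟩
  rcases hm i j hij with h | h
  · exact h.eq_of_tgt _ _
  · rw [← cancel_epi (p.f i), reassoc_of% hψ i, p.comm_assoc, hψ j, φ.comm]

variable [HasZeroObject V] {ι' : Type*} {c' : ComplexShape ι'}

theorem stupidTrunc_d_comp_stupidTruncXIso_hom (K : HomologicalComplex V c') (e : c.Embedding c')
    [e.IsRelIff] {i j : ι} {i' j' : ι'} (hi : e.f i = i') (hj : e.f j = j') :
    (K.stupidTrunc e).d i' j' ≫ (K.stupidTruncXIso e hj).hom =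
      (K.stupidTruncXIso e hi).hom ≫ K.d i' j' := by
  subst hi hj
  simp [stupidTrunc, stupidTruncXIso, extend_d_eq _ e rfl rfl, restriction]
  exact (Category.comp_id _).trans (Category.id_comp _).symm

end HomologicalComplex

namespace CochainComplex

open HomologicalComplex

variable {V : Type*} [Category* V] [HasZeroMorphisms V] [HasZeroObject V]

theorem embeddingUpIntGE_f_toNat {a i : ℤ} (h : a ≤ i) :
    (ComplexShape.embeddingUpIntGE a).f (i - a).toNat = i := by
  change a + ((i - a).toNat : ℤ) = i
  omega

theorem embeddingUpIntLE_f_toNat {b i : ℤ} (h : i ≤ b) :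
    (ComplexShape.embeddingUpIntLE b).f (b - i).toNat = i := by
  change b - ((b - i).toNat : ℤ) = i
  omega

theorem isZero_stupidTruncGE_X (K : CochainComplex V ℤ) {a i : ℤ} (h : i < a) :
    IsZero ((K.stupidTrunc (ComplexShape.embeddingUpIntGE a)).X i) :=
  K.isZero_stupidTrunc_X _ i fun j hj ↦ by
    change a + (j : ℤ) = i at hj
    omega

theorem isZero_stupidTruncLE_X (K : CochainComplex V ℤ) {b i : ℤ} (h : b < i) :
    IsZero ((K.stupidTrunc (ComplexShape.embeddingUpIntLE b)).X i) :=
  K.isZero_stupidTrunc_X _ i fun j hj ↦ by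
    change b - (j : ℤ) = i at hj
    omega

/-- The inclusion of the hard truncation in degrees `≥ a`. -/
noncomputable def stupidTruncGEι (K : CochainComplex V ℤ) (a : ℤ) :
    K.stupidTrunc (ComplexShape.embeddingUpIntGE a) ⟶ K where
  f i := if h : a ≤ i then (K.stupidTruncXIso _ (embeddingUpIntGE_f_toNat h)).hom else 0
  comm' i j hij := by
    have hij' : i + 1 = j := hij
    by_cases hi : a ≤ i
    · have hj : a ≤ j := by omega
      simp only [hi, hj, dite_true]
      rw [stupidTrunc_d_comp_stupidTruncXIso_hom]
    · exact (isZero_stupidTruncGE_X K (by omega)).eq_of_src _ _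

/-- The projection to the hard truncation in degrees `≤ b`. -/
noncomputable def stupidTruncLEπ (K : CochainComplex V ℤ) (b : ℤ) :
    K ⟶ K.stupidTrunc (ComplexShape.embeddingUpIntLE b) where
  f i := if h : i ≤ b then (K.stupidTruncXIso _ (embeddingUpIntLE_f_toNat h)).inv else 0
  comm' i j hij := by
    have hij' : i + 1 = j := hij
    by_cases hj : j ≤ b
    · have hi : i ≤ b := by omega
      simp only [hi, hj, dite_true]
      rw [Iso.inv_comp_eq, ← Category.assoc, Iso.eq_comp_inv]
      exact stupidTrunc_d_comp_stupidTruncXIso_hom _ _ _ _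
    · exact (isZero_stupidTruncLE_X K (by omega)).eq_of_tgt _ _

theorem isIso_stupidTruncGEι_f (K : CochainComplex V ℤ) {a i : ℤ} (h : a ≤ i) :
    IsIso ((K.stupidTruncGEι a).f i) := by
  simp only [stupidTruncGEι, h, dite_true]
  infer_instance

theorem isIso_stupidTruncLEπ_f (K : CochainComplex V ℤ) {b i : ℤ} (h : i ≤ b) :
    IsIso ((K.stupidTruncLEπ b).f i) := by
  simp only [stupidTruncLEπ, h, dite_true]
  infer_instance

theorem stupidTruncGEι_naturality {K L : CochainComplex V ℤ} (φ : K ⟶ L) (a : ℤ) :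
    stupidTruncMap φ (ComplexShape.embeddingUpIntGE a) ≫ L.stupidTruncGEι a =
      K.stupidTruncGEι a ≫ φ := by
  ext i
  by_cases h : a ≤ i
  · simp [stupidTruncGEι, h]
  · exact (isZero_stupidTruncGE_X K (by omega)).eq_of_src _ _

theorem stupidTruncLEπ_naturality {K L : CochainComplex V ℤ} (φ : K ⟶ L) (b : ℤ) :
    K.stupidTruncLEπ b ≫ stupidTruncMap φ (ComplexShape.embeddingUpIntLE b) =
      φ ≫ L.stupidTruncLEπ b := by
  ext i
  by_cases h : i ≤ b
  · simp only [comp_f, stupidTruncLEπ, h, dite_true]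
    rw [Iso.inv_comp_eq, ← stupidTruncMap_stupidTruncXIso_hom_assoc, Iso.hom_inv_id,
      Category.comp_id]
  · exact (isZero_stupidTruncLE_X L (by omega)).eq_of_tgt _ _

theorem mono_stupidTruncGEι_f (K : CochainComplex V ℤ) (a i : ℤ) :
    Mono ((K.stupidTruncGEι a).f i) := by
  by_cases h : a ≤ i
  · have := isIso_stupidTruncGEι_f K h
    infer_instance
  · exact ⟨fun _ _ _ ↦ (isZero_stupidTruncGE_X K (by omega)).eq_of_tgt _ _⟩

theorem epi_stupidTruncLEπ_f (K : CochainComplex V ℤ) (b i : ℤ) :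
    Epi ((K.stupidTruncLEπ b).f i) := by
  by_cases h : i ≤ b
  · have := isIso_stupidTruncLEπ_f K h
    infer_instance
  · exact ⟨fun _ _ _ ↦ (isZero_stupidTruncLE_X K (by omega)).eq_of_src _ _⟩

end CochainComplex

/-! ### Idempotents, finite length and the Fitting lemma for complexes of fixed size. -/

namespace FixedSize

variable {A : Type u} [Ring A] {m n : ℤ}

theorem isFixedSizeProj_of_retract {K L : CochainComplex (ModuleCat.{u} A) ℤ} (i : K ⟶ L)
    (r : L ⟶ K) (h : i ≫ r = 𝟙 K) (hL : isFixedSizeProj A m n L) : isFixedSizeProj A m n K := by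
  have hd (j : ℤ) : i.f j ≫ r.f j = 𝟙 (K.X j) := by
    rw [← HomologicalComplex.comp_f, h, HomologicalComplex.id_f]
  have hl (j : ℤ) : (r.f j).hom ∘ₗ (i.f j).hom = LinearMap.id := by
    rw [← ModuleCat.hom_comp, hd, ModuleCat.hom_id]
  refine ⟨fun j ↦ ?_, fun j hj ↦ ?_⟩
  · have := (hL.1 j).1
    have := (hL.1 j).2
    exact ⟨Module.Finite.of_surjective (r.f j).hom
      fun x ↦ ⟨(i.f j).hom x, LinearMap.congr_fun (hl j) x⟩,
      Module.Projective.of_split _ _ (hl j)⟩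
  · rw [IsZero.iff_id_eq_zero, ← hd j, (hL.2 j hj).eq_of_tgt (i.f j) 0, zero_comp]

instance : IsIdempotentComplete (FixedSize A m n) where
  idempotents_split X p hp := by
    have hp' : p.hom ≫ p.hom = p.hom := congrArg (·.hom) hp
    obtain ⟨K, i, r, hir, hri⟩ := IsIdempotentComplete.idempotents_split X.obj p.hom hp'
    exact ⟨⟨K, isFixedSizeProj_of_retract i r hir X.property⟩, ObjectProperty.homMk i,
      ObjectProperty.homMk r, by ext1; exact hir, by ext1; exact hri⟩

theorem isZero_iff (X : FixedSize A m n) : IsZero X ↔ ∀ i, IsZero (X.obj.X i) := by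
  constructor
  · intro h i
    have h0 : 𝟙 X.obj = 0 := congrArg (·.hom) ((IsZero.iff_id_eq_zero X).1 h)
    rw [IsZero.iff_id_eq_zero, ← HomologicalComplex.id_f, h0, HomologicalComplex.zero_f]
  · intro h
    rw [IsZero.iff_id_eq_zero]
    apply ObjectProperty.hom_ext
    ext1 i
    exact (h i).eq_of_src _ _

theorem _root_.ModuleCat.length_eq_add_of_complementary {M N K : ModuleCat.{u} A} (i : N ⟶ M)
    (r : M ⟶ N) (k : K ⟶ M) (q : M ⟶ K) (hir : i ≫ r = 𝟙 N) (hkq : k ≫ q = 𝟙 K) (hiq : i ≫ q = 0)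
    (h : r ≫ i + q ≫ k = 𝟙 M) : Module.length A M = Module.length A N + Module.length A K := by
  refine Module.length_eq_add_of_exact i.hom q.hom ?_ ?_ ?_
  · exact Function.LeftInverse.injective (g := r.hom) (ConcreteCategory.congr_hom hir)
  · exact Function.RightInverse.surjective (g := k.hom) (ConcreteCategory.congr_hom hkq)
  · intro x
    constructor
    · intro hx
      have hx' : i.hom (r.hom x) + k.hom (q.hom x) = x := ConcreteCategory.congr_hom h x
      rw [hx, map_zero, add_zero] at hx'
      exact ⟨r.hom x, hx'⟩
    · rintro ⟨y, rfl⟩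
      exact ConcreteCategory.congr_hom hiq y

/-- The total length of the entries of a complex. -/
noncomputable def size (X : FixedSize A m n) : ℕ :=
  ∑ i ∈ Finset.Icc m n, (Module.length A (X.obj.X i)).toNat

theorem isNoetherian_X [IsNoetherianRing A] (X : FixedSize A m n) (i : ℤ) :
    IsNoetherian A (X.obj.X i) := by
  have := (X.property.1 i).1
  infer_instance

theorem isArtinian_X [IsArtinianRing A] (X : FixedSize A m n) (i : ℤ) :
    IsArtinian A (X.obj.X i) := by
  have := (X.property.1 i).1
  infer_instance

theorem length_X_ne_top [IsArtinianRing A] (X : FixedSize A m n) (i : ℤ) :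
    Module.length A (X.obj.X i) ≠ ⊤ := by
  have := isNoetherian_X X i
  have := isArtinian_X X i
  exact Module.length_ne_top

theorem size_pos [IsArtinianRing A] (X : FixedSize A m n) (h : ¬ IsZero X) : 0 < size X := by
  rw [Nat.pos_iff_ne_zero]
  intro h0
  refine h ((isZero_iff X).2 fun i ↦ ?_)
  by_cases hi : i ∈ Set.Icc m n
  · have h1 := Finset.sum_eq_zero_iff.1 h0 i (by simpa using hi)
    have h2 := (ENat.toNat_eq_zero.1 h1).resolve_right (length_X_ne_top X i)
    rw [Module.length_eq_zero_iff] at h2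
    exact ModuleCat.isZero_of_subsingleton _
  · exact X.property.2 i hi

theorem size_eq_add [IsArtinianRing A] (X Y Z : FixedSize A m n) (e : X ≅ Y ⊞ Z) :
    size X = size Y + size Z := by
  rw [size, size, size, ← Finset.sum_add_distrib]
  refine Finset.sum_congr rfl fun j _ ↦ ?_
  rw [← ENat.toNat_add (length_X_ne_top Y j) (length_X_ne_top Z j)]
  congr 1
  have hir : (biprod.inl ≫ e.inv) ≫ (e.hom ≫ biprod.fst) = 𝟙 Y := by simp
  have hkq : (biprod.inr ≫ e.inv) ≫ (e.hom ≫ biprod.snd) = 𝟙 Z := by simp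
  have hiq : (biprod.inl ≫ e.inv) ≫ (e.hom ≫ biprod.snd) = (0 : Y ⟶ Z) := by simp
  have ht : (e.hom ≫ biprod.fst) ≫ (biprod.inl ≫ e.inv) +
      (e.hom ≫ biprod.snd) ≫ (biprod.inr ≫ e.inv) = 𝟙 X := by
    calc _ = e.hom ≫ (biprod.fst ≫ biprod.inl + biprod.snd ≫ biprod.inr) ≫ e.inv := by
            simp only [Preadditive.add_comp, Preadditive.comp_add, Category.assoc]
      _ = _ := by rw [biprod.total, Category.id_comp, e.hom_inv_id]
  exact ModuleCat.length_eq_add_of_complementary _ _ _ _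
    (congrArg (fun t : Y ⟶ Y ↦ t.hom.f j) hir) (congrArg (fun t : Z ⟶ Z ↦ t.hom.f j) hkq)
    (congrArg (fun t : Y ⟶ Z ↦ t.hom.f j) hiq) (congrArg (fun t : X ⟶ X ↦ t.hom.f j) ht)

theorem id_mem_closure_indecomposableIdempotents [IsArtinianRing A] (X : FixedSize A m n) :
    𝟙 X ∈ AddSubgroup.closure (indecomposableIdempotents X) :=
  _root_.id_mem_closure_indecomposableIdempotents size size_pos size_eq_add X

/-- The action of the endomorphism monoid of a complex on an entry. -/
def endToModuleEnd (X : FixedSize A m n) (i : ℤ) : End X →* Module.End A (X.obj.X i) where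
  toFun f := (InducedCategory.Hom.hom f |>.f i).hom
  map_one' := rfl
  map_mul' _ _ := rfl

/-- A map intertwining `g` and `g'` sends range to range and kernel to kernel, hence respects the
two decompositions. This makes the degreewise Fitting projections a chain map. -/
theorem _root_.isCompl_range_ker_projection_comm {M N : Type*} [AddCommGroup M] [AddCommGroup N]
    [Module A M] [Module A N] (g : Module.End A M) (g' : Module.End A N) (d : M →ₗ[A] N)
    (hd : ∀ x, d (g x) = g' (d x)) (h : IsCompl (LinearMap.range g) (LinearMap.ker g))
    (h' : IsCompl (LinearMap.range g') (LinearMap.ker g'))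
    (x : M) : d (Submodule.projection _ _ h x) = Submodule.projection _ _ h' (d x) := by
  obtain ⟨y, hy, z, hz, rfl⟩ := Submodule.mem_sup.1 (h.sup_eq_top ▸ Submodule.mem_top : x ∈ _)
  obtain ⟨w, rfl⟩ := hy
  have hz' : d z ∈ LinearMap.ker g' := by
    rw [LinearMap.mem_ker] at hz ⊢
    rw [← hd, hz, map_zero]
  have hy' : d (g w) ∈ LinearMap.range g' := ⟨d w, (hd w).symm⟩
  have e1 := Submodule.projection_apply_left h ⟨g w, w, rfl⟩
  have e2 := Submodule.projection_apply_left h' ⟨_, hy'⟩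
  have e3 := Submodule.projection_apply_eq_zero_iff h |>.2 hz
  have e4 := Submodule.projection_apply_eq_zero_iff h' |>.2 hz'
  simp only at e1 e2
  simp [map_add, e1, e2, e3, e4]

/-- The Fitting lemma for complexes of fixed size. -/
theorem isIso_or_pow_eq_zero [IsArtinianRing A] {X : FixedSize A m n} (hX : Indecomposable X)
    (f : End X) : IsIso (show X ⟶ X from f) ∨ ∃ N : ℕ, f ^ N = (0 : X ⟶ X) := by
  -- Only finitely many degrees matter, so one exponent serves them all; `1 ≤ N` is needed to pass
  -- from `f ^ N` invertible to `f` invertible.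
  have hN : ∃ N : ℕ, 1 ≤ N ∧ ∀ i ∈ Finset.Icc m n, IsCompl
      (LinearMap.ker (endToModuleEnd X i f ^ N)) (LinearMap.range (endToModuleEnd X i f ^ N)) := by
    have h : ∀ i ∈ Finset.Icc m n, ∀ᶠ N : ℕ in Filter.atTop, IsCompl
      (LinearMap.ker (endToModuleEnd X i f ^ N))
      (LinearMap.range (endToModuleEnd X i f ^ N)) := fun i _ ↦ by
        have := isNoetherian_X X i
        have := isArtinian_X X i
        exact (endToModuleEnd X i f).eventually_isCompl_ker_pow_range_pow
    exact ((Filter.eventually_ge_atTop 1).and ((Filter.eventually_all_finset _).2 h)).exists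
  obtain ⟨N, hN1, hN⟩ := hN
  let g : ∀ i, Module.End A (X.obj.X i) := fun i ↦ endToModuleEnd X i (f ^ N)
  have hg : ∀ i, IsCompl (LinearMap.range (g i)) (LinearMap.ker (g i)) := by
    intro i
    by_cases hi : i ∈ Finset.Icc m n
    · simpa [g, map_pow] using (hN i hi).symm
    · have := ModuleCat.subsingleton_of_isZero (X.property.2 i (by simpa using hi))
      exact ⟨disjoint_iff.2 (Subsingleton.elim _ _), codisjoint_iff.2 (Subsingleton.elim _ _)⟩
  -- Projection onto the image of `f ^ N` along its kernel. Indecomposability makes it `0`, so `f ^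
  -- N = 0`, or the identity, so `f ^ N` is bijective in each degree.
  let e : X ⟶ X := ObjectProperty.homMk
    { f := fun i ↦ ModuleCat.ofHom (Submodule.projection _ _ (hg i))
      comm' := fun i j _ ↦ by
        ext x
        refine (isCompl_range_ker_projection_comm (g i) (g j) (X.obj.d i j).hom (fun x ↦ ?_)
          (hg i) (hg j) x)
        exact (ConcreteCategory.congr_hom
          ((InducedCategory.Hom.hom (f ^ N : End X)).comm i j) x) }
  have he : e ≫ e = e := by
    ext i x
    change Submodule.projection _ _ (hg i) (Submodule.projection _ _ (hg i) x) = Submodule.projection _ _ (hg i) x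
    simp
  rcases eq_zero_or_eq_id_of_indecomposable hX e he with h | h
  · right
    refine ⟨N, ?_⟩
    have hz : ∀ i x, Submodule.projection _ _ (hg i) x = 0 := fun i x ↦
      congrArg (fun t : X ⟶ X ↦ (t.hom.f i).hom x) h
    refine ObjectProperty.hom_ext _ (HomologicalComplex.hom_ext _ _ fun i ↦ ?_)
    ext x
    change g i x = 0
    have := Submodule.projection_apply_left (hg i) ⟨g i x, x, rfl⟩
    rw [hz] at this
    exact this.symm
  · left
    have hz : ∀ i x, Submodule.projection _ _ (hg i) x = x := fun i x ↦
      congrArg (fun t : X ⟶ X ↦ (t.hom.f i).hom x) h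
    have hbij : ∀ i, Function.Bijective (g i) := by
      intro i
      constructor
      · rw [← LinearMap.ker_eq_bot, eq_bot_iff]
        intro x hx
        exact Submodule.mem_bot A |>.2 ((hz i x).symm.trans
          ((Submodule.projection_apply_eq_zero_iff (hg i)).2 hx))
      · intro x
        have : Submodule.projection _ _ (hg i) x ∈ LinearMap.range (g i) := Submodule.projection_apply_mem _ x
        rw [hz] at this
        exact this
    have hiso : IsIso (show X ⟶ X from f ^ N) := by
      have : IsIso ((isFixedSizeProj A m n).ι.map (show X ⟶ X from f ^ N)) := by
        have (i : ℤ) : IsIso (((isFixedSizeProj A m n).ι.map (show X ⟶ X from f ^ N)).f i) :=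
          (ConcreteCategory.isIso_iff_bijective _).2 (hbij i)
        exact HomologicalComplex.Hom.isIso_of_components _
      exact isIso_of_reflects_iso _ (isFixedSizeProj A m n).ι
    have hu : IsUnit (f ^ N) := (isUnit_iff_isIso _).2 hiso
    exact (isUnit_iff_isIso f).1 ((isUnit_pow_iff (by omega)).1 hu)

end FixedSize

/-! ### Extending factorizations along hard truncations. -/

namespace FixedSize

open HomologicalComplex CochainComplex

variable {A : Type u} [Ring A] {m n : ℤ}

theorem isFixedSizeProj_of_degreewise_iso {K : CochainComplex (ModuleCat.{u} A) ℤ}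
    (h : ∀ i, ∃ N : ModuleCat.{u} A, (Module.Finite A N ∧ Module.Projective A N) ∧
      (i ∉ Set.Icc m n → IsZero N) ∧ Nonempty (N ≅ K.X i)) :
    isFixedSizeProj A m n K := by
  refine ⟨fun i ↦ ?_, fun i hi ↦ ?_⟩
  · obtain ⟨N, ⟨_, _⟩, _, ⟨e⟩⟩ := h i
    exact ⟨Module.Finite.equiv e.toLinearEquiv, Module.Projective.of_equiv e.toLinearEquiv⟩
  · obtain ⟨N, _, h0, ⟨e⟩⟩ := h i
    exact (h0 hi).of_iso e.symm

variable {a : ℤ} {X Y : FixedSize A m n}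

/-- Factorizations of a left hard truncation extend to factorizations of the given morphism. -/
theorem exists_factorization_of_truncGE (hma : m ≤ a) (f : X ⟶ Y) {Z : FixedSize A a n}
    (g : (truncGEFunctor m n a).obj X ⟶ Z) (h : Z ⟶ (truncGEFunctor m n a).obj Y)
    (w : g ≫ h = (truncGEFunctor m n a).map f) :
    ∃ (Z' : FixedSize A m n) (g' : X ⟶ Z') (h' : Z' ⟶ Y), g' ≫ h' = f ∧
      (IsSplitMono g' → IsSplitMono g) ∧
      (IsSplitEpi h' → IsSplitEpi h ∧ ∀ i < a, IsSplitEpi (f.hom.f i)) := by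
  let ιX := X.obj.stupidTruncGEι a
  let ιY := Y.obj.stupidTruncGEι a
  let g₀ : X.obj.stupidTrunc (ComplexShape.embeddingUpIntGE a) ⟶ Z.obj := g.hom
  let h₀ : Z.obj ⟶ Y.obj.stupidTrunc (ComplexShape.embeddingUpIntGE a) := h.hom
  have w₀ : g₀ ≫ h₀ = stupidTruncMap f.hom _ := congrArg (·.hom) w
  have hZ : ∀ i < a, IsZero (Z.obj.X i) := fun i hi ↦ Z.property.2 i fun h ↦ by
    have := h.1
    omega
  have hιX : Mono ιX := by
    have := X.obj.mono_stupidTruncGEι_f a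
    exact mono_of_mono_f _ this
  have hιY : Mono ιY := by
    have := Y.obj.mono_stupidTruncGEι_f a
    exact mono_of_mono_f _ this
  -- Colimits are degreewise: the pushout is `Z` in degrees at least `a`, where `ιX` is invertible,
  -- and `X` below `a`, where the other two corners vanish. Its entries are thus finitely generated
  -- projective.
  have sq := IsPushout.of_hasPushout ιX g₀
  let inl := pushout.inl ιX g₀
  let inr := pushout.inr ιX g₀
  have sqi (i : ℤ) : IsPushout (ιX.f i) (g₀.f i) (inl.f i) (inr.f i) := sq.map (eval _ _ i)
  have hinr : ∀ i, a ≤ i → IsIso (inr.f i) := fun i hi ↦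
    (sqi i).isIso_inr_of_isIso (X.obj.isIso_stupidTruncGEι_f hi)
  have hinl : ∀ i < a, IsIso (inl.f i) := fun i hi ↦
    (sqi i).isIso_inl_of_isIso (isIso_of_source_target_iso_zero _
      (isZero_stupidTruncGE_X X.obj hi).isoZero (hZ i hi).isoZero)
  have hinr' : ∀ i, Mono (inr.f i) := fun i ↦ by
    by_cases hi : a ≤ i
    · have := hinr i hi
      infer_instance
    · exact ⟨fun _ _ _ ↦ (hZ i (by omega)).eq_of_tgt _ _⟩
  have hinrm : Mono inr := mono_of_mono_f _ hinr'
  let hh : pushout ιX g₀ ⟶ Y.obj := pushout.desc f.hom (h₀ ≫ ιY) (by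
    rw [reassoc_of% w₀]
    exact (stupidTruncGEι_naturality f.hom a).symm)
  have hinlh : inl ≫ hh = f.hom := pushout.inl_desc _ _ _
  have hinrh : inr ≫ hh = h₀ ≫ ιY := pushout.inr_desc _ _ _
  have hP : isFixedSizeProj A m n (pushout ιX g₀) := by
    refine isFixedSizeProj_of_degreewise_iso fun i ↦ ?_
    by_cases hi : a ≤ i
    · have := hinr i hi
      exact ⟨Z.obj.X i, Z.property.1 i,
        fun h ↦ Z.property.2 i fun h' ↦ h ⟨hma.trans h'.1, h'.2⟩, ⟨asIso (inr.f i)⟩⟩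
    · have := hinl i (by omega)
      exact ⟨X.obj.X i, X.property.1 i, X.property.2 i, ⟨asIso (inl.f i)⟩⟩
  refine ⟨⟨pushout ιX g₀, hP⟩, ObjectProperty.homMk inl, ObjectProperty.homMk hh,
    by ext1; exact hinlh, fun ⟨⟨r⟩⟩ ↦ ?_, fun ⟨⟨s⟩⟩ ↦ ⟨?_, fun i hi ↦ ?_⟩⟩
  · have hr : inl ≫ r.retraction.hom = 𝟙 _ := congrArg (·.hom) r.id
    -- `Z` lives in degrees at least `a`, so the retraction restricted to `Z` lands in the
    -- truncation of `X`.
    obtain ⟨ρ, hρ⟩ := exists_lift_of_degreewise (inr ≫ r.retraction.hom) ιX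
      (fun i ↦ by
        by_cases hi : a ≤ i
        · have := X.obj.isIso_stupidTruncGEι_f hi
          exact ⟨(inr ≫ r.retraction.hom).f i ≫ inv (ιX.f i), by simp [ιX]⟩
        · exact ⟨0, (hZ i (by omega)).eq_of_src _ _⟩)
      (fun i j _ ↦ Or.inr (X.obj.mono_stupidTruncGEι_f a j))
    refine ⟨⟨⟨ObjectProperty.homMk ρ, ?_⟩⟩⟩
    ext1
    change g₀ ≫ ρ = 𝟙 _
    rw [← cancel_mono ιX, Category.assoc, hρ, ← sq.w_assoc]
    erw [hr]
    simp
  · have hs : s.section_.hom ≫ hh = 𝟙 _ := congrArg (·.hom) s.id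
    obtain ⟨σ, hσ⟩ := exists_lift_of_degreewise (ιY ≫ s.section_.hom) inr
      (fun i ↦ by
        by_cases hi : a ≤ i
        · have := hinr i hi
          exact ⟨(ιY ≫ s.section_.hom).f i ≫ inv (inr.f i), by simp⟩
        · exact ⟨0, (isZero_stupidTruncGE_X _ (by omega)).eq_of_src _ _⟩)
      (fun i j _ ↦ Or.inr (hinr' j))
    refine ⟨⟨⟨ObjectProperty.homMk σ, ?_⟩⟩⟩
    ext1
    change σ ≫ h₀ = 𝟙 _
    rw [← cancel_mono ιY, Category.assoc, ← hinrh, reassoc_of% hσ]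
    erw [hs]
    simp
  · have hs : s.section_.hom ≫ hh = 𝟙 _ := congrArg (·.hom) s.id
    have := hinl i hi
    refine ⟨⟨⟨s.section_.hom.f i ≫ inv (inl.f i), ?_⟩⟩⟩
    rw [← hinlh, Category.assoc, comp_f, IsIso.inv_hom_id_assoc, ← comp_f, hs, id_f]

variable {b : ℤ}

/-- Factorizations of a right hard truncation extend to factorizations of the given morphism. -/
theorem exists_factorization_of_truncLE (hbn : b ≤ n) (f : X ⟶ Y) {Z : FixedSize A m b}
    (g : (truncLEFunctor m n b).obj X ⟶ Z) (h : Z ⟶ (truncLEFunctor m n b).obj Y)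
    (w : g ≫ h = (truncLEFunctor m n b).map f) :
    ∃ (Z' : FixedSize A m n) (g' : X ⟶ Z') (h' : Z' ⟶ Y), g' ≫ h' = f ∧
      (IsSplitMono g' → IsSplitMono g) ∧ (IsSplitEpi h' → IsSplitEpi h) := by
  let πX := X.obj.stupidTruncLEπ b
  let πY := Y.obj.stupidTruncLEπ b
  let g₀ : X.obj.stupidTrunc (ComplexShape.embeddingUpIntLE b) ⟶ Z.obj := g.hom
  let h₀ : Z.obj ⟶ Y.obj.stupidTrunc (ComplexShape.embeddingUpIntLE b) := h.hom
  have w₀ : g₀ ≫ h₀ = stupidTruncMap f.hom _ := congrArg (·.hom) w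
  have hZ : ∀ i, b < i → IsZero (Z.obj.X i) := fun i hi ↦ Z.property.2 i fun h ↦ by
    have := h.2
    omega
  have hπX : Epi πX := by
    have := X.obj.epi_stupidTruncLEπ_f b
    exact epi_of_epi_f _ this
  have hπY : Epi πY := by
    have := Y.obj.epi_stupidTruncLEπ_f b
    exact epi_of_epi_f _ this
  -- Dually, this pullback is `Z` in degrees at most `b` and `Y` above.
  have sq := IsPullback.of_hasPullback πY h₀
  let fst := pullback.fst πY h₀
  let snd := pullback.snd πY h₀
  have sqi (i : ℤ) : IsPullback (fst.f i) (snd.f i) (πY.f i) (h₀.f i) := sq.map (eval _ _ i)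
  have hsnd : ∀ i ≤ b, IsIso (snd.f i) := fun i hi ↦
    (sqi i).isIso_snd_of_isIso (Y.obj.isIso_stupidTruncLEπ_f hi)
  have hfst : ∀ i, b < i → IsIso (fst.f i) := fun i hi ↦
    (sqi i).isIso_fst_of_isIso (isIso_of_source_target_iso_zero _
      (hZ i hi).isoZero (isZero_stupidTruncLE_X Y.obj hi).isoZero)
  have hsnd' : ∀ i, Epi (snd.f i) := fun i ↦ by
    by_cases hi : i ≤ b
    · have := hsnd i hi
      infer_instance
    · exact ⟨fun _ _ _ ↦ (hZ i (by omega)).eq_of_src _ _⟩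
  have hsnde : Epi snd := epi_of_epi_f _ hsnd'
  let gg : X.obj ⟶ pullback πY h₀ := pullback.lift f.hom (πX ≫ g₀) (by
    rw [Category.assoc, w₀]
    exact (stupidTruncLEπ_naturality f.hom b).symm)
  have hgfst : gg ≫ fst = f.hom := pullback.lift_fst _ _ _
  have hgsnd : gg ≫ snd = πX ≫ g₀ := pullback.lift_snd _ _ _
  have hP : isFixedSizeProj A m n (pullback πY h₀) := by
    refine isFixedSizeProj_of_degreewise_iso fun i ↦ ?_
    by_cases hi : i ≤ b
    · have := hsnd i hi
      exact ⟨Z.obj.X i, Z.property.1 i,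
        fun h ↦ Z.property.2 i fun h' ↦ h ⟨h'.1, h'.2.trans hbn⟩, ⟨(asIso (snd.f i)).symm⟩⟩
    · have := hfst i (by omega)
      exact ⟨Y.obj.X i, Y.property.1 i, Y.property.2 i, ⟨(asIso (fst.f i)).symm⟩⟩
  refine ⟨⟨pullback πY h₀, hP⟩, ObjectProperty.homMk gg, ObjectProperty.homMk fst,
    by ext1; exact hgfst, fun ⟨⟨r⟩⟩ ↦ ?_, fun ⟨⟨s⟩⟩ ↦ ?_⟩
  · have hr : gg ≫ r.retraction.hom = 𝟙 _ := congrArg (·.hom) r.id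
    obtain ⟨ρ, hρ⟩ := exists_desc_of_degreewise (r.retraction.hom ≫ πX) snd
      (fun i ↦ by
        by_cases hi : i ≤ b
        · have := hsnd i hi
          exact ⟨inv (snd.f i) ≫ (r.retraction.hom ≫ πX).f i, by simp⟩
        · exact ⟨0, (isZero_stupidTruncLE_X _ (by omega)).eq_of_tgt _ _⟩)
      (fun i j _ ↦ Or.inr (hsnd' i))
    refine ⟨⟨⟨ObjectProperty.homMk ρ, ?_⟩⟩⟩
    ext1
    change g₀ ≫ ρ = 𝟙 _
    rw [← cancel_epi πX, ← reassoc_of% hgsnd, hρ, reassoc_of% hr]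
    simp
  · have hs : s.section_.hom ≫ fst = 𝟙 _ := congrArg (·.hom) s.id
    obtain ⟨σ, hσ⟩ := exists_desc_of_degreewise (s.section_.hom ≫ snd) πY
      (fun i ↦ by
        by_cases hi : i ≤ b
        · have := Y.obj.isIso_stupidTruncLEπ_f hi
          exact ⟨inv (πY.f i) ≫ (s.section_.hom ≫ snd).f i, by simp [πY]⟩
        · exact ⟨0, (hZ i (by omega)).eq_of_tgt _ _⟩)
      (fun i j _ ↦ Or.inr (Y.obj.epi_stupidTruncLEπ_f b i))
    refine ⟨⟨⟨ObjectProperty.homMk σ, ?_⟩⟩⟩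
    ext1
    change σ ≫ h₀ = 𝟙 _
    rw [← cancel_epi πY, reassoc_of% hσ, ← sq.w, reassoc_of% hs]
    simp

end FixedSize

/-! ### Complexes concentrated in degree 0, and the two halves of the proposition. -/

theorem isSplitMono_of_comp_isIso {C : Type*} [Category* C] {X Y X' Y' : C} (f : X ⟶ Y)
    (f' : X' ⟶ Y') (p : X ⟶ X') (q : Y ⟶ Y') [IsIso p] (h : p ≫ f' = f ≫ q) [IsSplitMono f'] :
    IsSplitMono f :=
  ⟨⟨⟨q ≫ retraction f' ≫ inv p, by rw [← reassoc_of% h]; simp⟩⟩⟩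

namespace FixedSize

open HomologicalComplex CochainComplex

variable {A : Type u} [Ring A] {n : ℤ}

theorem isZero_X_of_isSplitMono {m : ℤ} {X Y : FixedSize A m n} (f : X ⟶ Y) [IsSplitMono f]
    {i : ℤ} (h : IsZero (Y.obj.X i)) : IsZero (X.obj.X i) := by
  have hf : f.hom.f i ≫ (retraction f).hom.f i = 𝟙 (X.obj.X i) :=
    congrArg (fun t : X ⟶ X ↦ t.hom.f i) (IsSplitMono.id f)
  rw [IsZero.iff_id_eq_zero, ← hf, h.eq_of_tgt (f.hom.f i) 0, zero_comp]

theorem isZero_X_of_isSplitEpi {m : ℤ} {X Y : FixedSize A m n} (f : X ⟶ Y) [IsSplitEpi f]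
    {i : ℤ} (h : IsZero (X.obj.X i)) : IsZero (Y.obj.X i) := by
  have hf : (section_ f).hom.f i ≫ f.hom.f i = 𝟙 (Y.obj.X i) :=
    congrArg (fun t : Y ⟶ Y ↦ t.hom.f i) (IsSplitEpi.id f)
  rw [IsZero.iff_id_eq_zero, ← hf, h.eq_of_tgt ((section_ f).hom.f i) 0, zero_comp]

/-- Degreewise retractions extend each `g.hom.f i`. The extension is a chain map because `X`
vanishes in nonzero degrees and `V` vanishes in degree `-1`. -/
theorem isStalkInjective_of_isZero {X : FixedSize A 0 n} (hX0 : ¬ IsZero (X.obj.X 0))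
    (h : ∀ i, i ≠ 0 → IsZero (X.obj.X i)) : IsStalkInjective X := by
  refine ⟨⟨0, hX0, h⟩, fun U V s hs g ↦ ?_⟩
  obtain ⟨ψ, hψ⟩ := exists_desc_of_degreewise g.hom s.hom
    (fun i ↦ by
      have := hs i
      exact ⟨retraction (s.hom.f i) ≫ g.hom.f i, by simp⟩)
    (fun i j hij ↦ by
      have hij' : i + 1 = j := hij
      by_cases hj : j = 0
      · right
        exact ⟨fun _ _ _ ↦ (V.property.2 i fun h ↦ by
          have := h.1
          omega).eq_of_src _ _⟩
      · exact Or.inl (h j hj))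
  exact ⟨ObjectProperty.homMk ψ, by ext1; exact hψ⟩

theorem IsStalkInjective.isZero_X {X : FixedSize A 0 n} (hX0 : ¬ IsZero (X.obj.X 0))
    (h : IsStalkInjective X) (i : ℤ) (hi : i ≠ 0) : IsZero (X.obj.X i) := by
  obtain ⟨⟨j, -, hj⟩, -⟩ := h
  obtain rfl : 0 = j := by
    by_contra h0
    exact hX0 (hj 0 h0)
  exact hj i hi

/-- An indecomposable complex with `X^0 ≠ 0` and `X^1 = 0` is concentrated in degree `0`. -/
theorem isZero_X_of_isZero_X_one {X : FixedSize A 0 n} (hX : Indecomposable X)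
    (hX0 : ¬ IsZero (X.obj.X 0)) (hX1 : IsZero (X.obj.X 1)) (i : ℤ) (hi : i ≠ 0) :
    IsZero (X.obj.X i) := by
  -- The projection onto degree 0 is a chain map because `X^1 = 0`; it is not zero, so it is the
  -- identity.
  let e : X ⟶ X := ObjectProperty.homMk
    { f := fun i ↦ if i = 0 then 𝟙 _ else 0
      comm' := fun i j hij ↦ by
        have hij' : i + 1 = j := hij
        by_cases hi : i = 0
        · subst hi
          subst hij'
          exact hX1.eq_of_tgt _ _
        by_cases hj : j = 0
        · exact (X.property.2 i fun h ↦ by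
            have := h.1
            omega).eq_of_src _ _
        · simp [hi, hj] }
  have he0 : e.hom.f 0 = 𝟙 _ := by simp [e]
  have hei : e.hom.f i = 0 := by simp [e, hi]
  have he : e ≫ e = e := by
    refine ObjectProperty.hom_ext _ (HomologicalComplex.hom_ext _ _ fun j ↦ ?_)
    by_cases hj : j = 0
    · subst hj
      change e.hom.f 0 ≫ e.hom.f 0 = e.hom.f 0
      simp [he0]
    · have hej : e.hom.f j = 0 := by simp [e, hj]
      change e.hom.f j ≫ e.hom.f j = e.hom.f j
      simp [hej]
  rcases eq_zero_or_eq_id_of_indecomposable hX e he with h | h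
  · exact absurd ((IsZero.iff_id_eq_zero _).2
      (he0.symm.trans (congrArg (fun t : X ⟶ X ↦ t.hom.f 0) h))) hX0
  · exact (IsZero.iff_id_eq_zero _).2
      ((congrArg (fun t : X ⟶ X ↦ t.hom.f i) h).symm.trans hei)

theorem isZero_X_of_isZero_functorF {X : FixedSize A 0 n} (h : IsZero ((functorF n).obj X))
    (i : ℤ) (hi : i ≠ 0) : IsZero (X.obj.X i) := by
  by_cases h1 : 1 ≤ i
  · have := X.obj.isIso_stupidTruncGEι_f h1
    exact ((isZero_iff _).1 h i).of_iso (asIso ((X.obj.stupidTruncGEι 1).f i)).symm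
  · exact X.property.2 i fun h ↦ by
      have := h.1
      omega

theorem functorF_map_zero (X Y : FixedSize A 0 n) : (functorF n).map (0 : X ⟶ Y) = 0 := by
  have : Mono (Y.obj.stupidTruncGEι 1) :=
    mono_of_mono_f _ (Y.obj.mono_stupidTruncGEι_f 1)
  ext1
  change stupidTruncMap (0 : X.obj ⟶ Y.obj) _ = 0
  rw [← cancel_mono (Y.obj.stupidTruncGEι 1), stupidTruncGEι_naturality, comp_zero, zero_comp]

theorem isIso_stupidTruncLEπ_of_isZero {X : FixedSize A 0 n} (hn : 2 ≤ n)
    (h : ∀ i, i ≠ 0 → IsZero (X.obj.X i)) : IsIso (X.obj.stupidTruncLEπ (n - 1)) := by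
  have (i : ℤ) : IsIso ((X.obj.stupidTruncLEπ (n - 1)).f i) := by
    by_cases hi : i ≤ n - 1
    · exact X.obj.isIso_stupidTruncLEπ_f hi
    · exact isIso_of_source_target_iso_zero _ (h i (by omega)).isoZero
        (isZero_stupidTruncLE_X X.obj (by omega)).isoZero
  exact Hom.isIso_of_components _

theorem isZero_X_one_of_functorG {X : FixedSize A 0 n} (hn : 2 ≤ n)
    (h : IsZero (((functorG n).obj X).obj.X 1)) : IsZero (X.obj.X 1) := by
  have := X.obj.isIso_stupidTruncLEπ_f (b := n - 1) (i := 1) (by omega)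
  exact h.of_iso (@asIso _ _ _ _ _ this)

theorem isZero_functorG_X_one {X : FixedSize A 0 n} (hn : 2 ≤ n)
    (h : IsZero (X.obj.X 1)) : IsZero (((functorG n).obj X).obj.X 1) := by
  have := X.obj.isIso_stupidTruncLEπ_f (b := n - 1) (i := 1) (by omega)
  exact h.of_iso (@asIso _ _ _ _ _ this).symm

variable {X Y : FixedSize A 0 n}

theorem isSplitMono_of_functorG (hn : 2 ≤ n) (hX : ∀ i, i ≠ 0 → IsZero (X.obj.X i)) (f : X ⟶ Y)
    (h : IsSplitMono ((functorG n).map f)) : IsSplitMono f := by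
  have := isIso_stupidTruncLEπ_of_isZero hn hX
  have h' : IsSplitMono ((isFixedSizeProj A 0 (n - 1)).ι.map ((functorG n).map f)) := inferInstance
  have h'' : IsSplitMono f.hom := @isSplitMono_of_comp_isIso _ _ _ _ _ _ f.hom _
    (X.obj.stupidTruncLEπ (n - 1)) (Y.obj.stupidTruncLEπ (n - 1)) _
    (stupidTruncLEπ_naturality f.hom (n - 1)) h'
  exact ⟨⟨⟨ObjectProperty.homMk (retraction f.hom), by ext1; exact IsSplitMono.id f.hom⟩⟩⟩

/-- The section of `G(f)` takes `Y^0` into the kernel of the differential out of degree 0. Since `2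
≤ n`, the truncation retains degree 1, so this is the kernel in `X` too and the section lifts. -/
theorem isSplitEpi_of_functorG (hn : 2 ≤ n) (hY : ∀ i, i ≠ 0 → IsZero (Y.obj.X i)) (f : X ⟶ Y)
    (h : IsSplitEpi ((functorG n).map f)) : IsSplitEpi f := by
  have := isIso_stupidTruncLEπ_of_isZero hn hY
  obtain ⟨⟨s⟩⟩ := h
  let σ : Y.obj.stupidTrunc (ComplexShape.embeddingUpIntLE (n - 1)) ⟶
    X.obj.stupidTrunc (ComplexShape.embeddingUpIntLE (n - 1)) := s.section_.hom
  have hσ : σ ≫ stupidTruncMap f.hom _ = 𝟙 _ := congrArg (·.hom) s.id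
  obtain ⟨ψ, hψ⟩ := exists_lift_of_degreewise (Y.obj.stupidTruncLEπ (n - 1) ≫ σ)
    (X.obj.stupidTruncLEπ (n - 1))
    (fun i ↦ by
      by_cases hi : i ≤ n - 1
      · have := X.obj.isIso_stupidTruncLEπ_f hi
        exact ⟨(Y.obj.stupidTruncLEπ (n - 1) ≫ σ).f i ≫
          inv ((X.obj.stupidTruncLEπ (n - 1)).f i), by simp⟩
      · exact ⟨0, (hY i (by omega)).eq_of_src _ _⟩)
    (fun i j hij ↦ by
      have hij' : i + 1 = j := hij
      by_cases hi : i = 0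
      · have := X.obj.isIso_stupidTruncLEπ_f (b := n - 1) (i := j) (by omega)
        exact Or.inr inferInstance
      · exact Or.inl (hY i hi))
  refine ⟨⟨⟨ObjectProperty.homMk ψ, ?_⟩⟩⟩
  ext1
  change ψ ≫ f.hom = 𝟙 _
  rw [← cancel_mono (Y.obj.stupidTruncLEπ (n - 1)), Category.assoc, ← stupidTruncLEπ_naturality,
    reassoc_of% hψ, hσ]
  simp

theorem isIrreducibleHom_functorG (hn : 2 ≤ n) (hX : Indecomposable X) (hY : Indecomposable Y)
    (hX0 : ¬ IsZero (X.obj.X 0)) (hY0 : ¬ IsZero (Y.obj.X 0)) (f : X ⟶ Y)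
    (hf : IsIrreducibleHom f) (h : IsStalkInjective X ∨ IsStalkInjective Y) :
    IsIrreducibleHom ((functorG n).map f) := by
  refine ⟨fun hm ↦ hf.1 ?_, fun he ↦ hf.2.1 ?_, fun Z g k w ↦ ?_⟩
  · refine isSplitMono_of_functorG hn ?_ f hm
    rcases h with h | h
    · exact IsStalkInjective.isZero_X hX0 h
    -- Splitness makes `X^1` a retract of `Y^1 = 0`, so `X` is itself concentrated in degree 0.
    · exact isZero_X_of_isZero_X_one hX hX0 (isZero_X_one_of_functorG hn
        (isZero_X_of_isSplitMono ((functorG n).map f)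
          (isZero_functorG_X_one hn (IsStalkInjective.isZero_X hY0 h 1 one_ne_zero))))
  · refine isSplitEpi_of_functorG hn ?_ f he
    rcases h with h | h
    · exact isZero_X_of_isZero_X_one hY hY0 (isZero_X_one_of_functorG hn
        (isZero_X_of_isSplitEpi ((functorG n).map f)
          (isZero_functorG_X_one hn (IsStalkInjective.isZero_X hX0 h 1 one_ne_zero))))
    · exact IsStalkInjective.isZero_X hY0 h
  · obtain ⟨Z', g', h', rfl, hg, hh⟩ := exists_factorization_of_truncLE (by omega) f g k w
    exact (hf.2.2 g' h' rfl).imp hg hh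

theorem isSplitMono_functorF_or_isSplitEpi (f : X ⟶ Y) (hf : IsIrreducibleHom f) :
    IsSplitMono ((functorF n).map f) ∨ IsSplitEpi (f.hom.f 0) := by
  obtain ⟨Z', g', h', hgh, hg, hh⟩ := exists_factorization_of_truncGE (a := 1) zero_le_one f
    ((functorF n).map f) (𝟙 _) (Category.comp_id _)
  exact (hf.2.2 g' h' hgh).imp hg fun h ↦ (hh h).2 0 one_pos

/-- An irreducible morphism between indecomposable complexes that are nonzero in degree `0` and not
concentrated there has non-isomorphic source and target. -/
theorem isEmpty_iso_of_isIrreducibleHom [IsArtinianRing A] (hX : Indecomposable X)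
    (hX0 : ¬ IsZero (X.obj.X 0)) (hXF : ¬ IsZero ((functorF n).obj X)) (f : X ⟶ Y)
    (hf : IsIrreducibleHom f) : IsEmpty (X ≅ Y) := by
  refine ⟨fun e ↦ ?_⟩
  -- By Fitting `θ` is invertible, making `f` an isomorphism, or nilpotent, contradicting that it is
  -- monic after `F` or epic in degree 0.
  let θ : End X := f ≫ e.inv
  rcases isIso_or_pow_eq_zero hX θ with h | ⟨N, hN⟩
  · have h' : IsIso (f ≫ e.inv) := h
    have : IsIso f := IsIso.of_isIso_comp_right f e.inv
    exact hf.1 inferInstance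
  · rcases isSplitMono_functorF_or_isSplitEpi f hf with h | h
    · refine hXF (isZero_of_mono_of_pow_eq_zero ((functorF n).mapEnd X θ) ?_ N ?_)
      · change Mono ((functorF n).map (f ≫ e.inv))
        rw [Functor.map_comp]
        infer_instance
      · rw [← map_pow, hN]
        exact functorF_map_zero X X
    · let E := (isFixedSizeProj A 0 n).ι ⋙ HomologicalComplex.eval _ _ 0
      refine hX0 (isZero_of_epi_of_pow_eq_zero (X := E.obj X) (E.mapEnd X θ) ?_ N ?_)
      · change Epi (E.map (f ≫ e.inv))
        rw [Functor.map_comp]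
        have : Epi (E.map f) := inferInstanceAs (Epi (f.hom.f 0))
        infer_instance
      · refine (map_pow (E.mapEnd X) θ N).symm.trans ?_
        rw [hN]
        rfl

theorem exists_common_summand_or_isRadicalIrreducible [IsArtinianRing A]
    (hXF : ¬ IsZero ((functorF n).obj X)) (hYF : ¬ IsZero ((functorF n).obj Y)) (f : X ⟶ Y)
    (hf : IsIrreducibleHom f) :
    (∃ W : FixedSize A 1 n, Indecomposable W ∧ IsDirectSummand W ((functorF n).obj X) ∧
      IsDirectSummand W ((functorF n).obj Y)) ∨
    (IsRadicalIrreducible ((functorF n).map f) ∧ IsSplitEpi (f.hom.f 0)) := by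
  by_cases hm : IsSplitMono ((functorF n).map f)
  · obtain ⟨W, i, r, hW, hir⟩ := exists_indecomposable_retract hXF
      (id_mem_closure_indecomposableIdempotents _)
    exact Or.inl ⟨W, hW, isDirectSummand_of_retract i r hir,
      isDirectSummand_of_retract (i ≫ (functorF n).map f)
        (retraction ((functorF n).map f) ≫ r) (by simp [hir])⟩
  by_cases he : IsSplitEpi ((functorF n).map f)
  · obtain ⟨W, i, r, hW, hir⟩ := exists_indecomposable_retract hYF
      (id_mem_closure_indecomposableIdempotents _)
    exact Or.inl ⟨W, hW, isDirectSummand_of_retract (i ≫ section_ ((functorF n).map f))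
      ((functorF n).map f ≫ r) (by simp [hir]), isDirectSummand_of_retract i r hir⟩
  by_cases hr : (functorF n).map f ∈ radicalHom ((functorF n).obj X) ((functorF n).obj Y)
  · refine Or.inr ⟨⟨hr, hm, he, fun Z g k w ↦ ?_⟩,
      (isSplitMono_functorF_or_isSplitEpi f hf).resolve_left hm⟩
    obtain ⟨Z', g', h', hgh, hg, hh⟩ := exists_factorization_of_truncGE zero_le_one f g k w
    exact (hf.2.2 g' h' hgh).imp hg fun h ↦ (hh h).1
  · obtain ⟨Z, W, a, b, a', b', hZ, -, hba, hba', hiso⟩ :=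
      exists_isIso_component_of_notMem_radicalHom _
        (id_mem_closure_indecomposableIdempotents _)
        (id_mem_closure_indecomposableIdempotents _) hr
    -- The invertible component makes `Z` a retract of `F(Y)` through `F(f)`.
    refine Or.inl ⟨Z, hZ, isDirectSummand_of_retract b a hba,
      isDirectSummand_of_retract (b ≫ (functorF n).map f)
        (a' ≫ inv (b ≫ (functorF n).map f ≫ a')) ?_⟩
    simpa only [Category.assoc] using IsIso.hom_inv_id (b ≫ (functorF n).map f ≫ a')

end FixedSize

theorem proposition2p6
    {R : Type w} [CommRing R] [IsArtinianRing R]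
    {A : Type u} [Ring A] [Algebra R A] [Module.Finite R A]
    (n : ℤ) (hn : 2 ≤ n)
    (X Y : FixedSize A 0 n) (hX : Indecomposable X) (hY : Indecomposable Y)
    (hX0 : ¬ IsZero (X.obj.X 0)) (hY0 : ¬ IsZero (Y.obj.X 0))
    (f : X ⟶ Y) (hf : IsIrreducibleHom f) :
    (¬ IsStalkInjective X → ¬ IsStalkInjective Y →
      (∃ W : FixedSize A 1 n, Indecomposable W ∧
        IsLeftEnlargement W X ∧ IsLeftEnlargement W Y ∧ IsEmpty (X ≅ Y)) ∨
      (IsRadicalIrreducible ((functorF n).map f) ∧ IsSplitEpi (f.hom.f 0))) ∧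
    (IsStalkInjective X ∨ IsStalkInjective Y → IsIrreducibleHom ((functorG n).map f)) := by
  refine ⟨fun hXs hYs ↦ ?_, FixedSize.isIrreducibleHom_functorG hn hX hY hX0 hY0 f hf⟩
  have : IsArtinianRing A := isArtinian_of_tower R inferInstance
  have hXF : ¬ IsZero ((functorF n).obj X) := fun h ↦
    hXs (FixedSize.isStalkInjective_of_isZero hX0 (FixedSize.isZero_X_of_isZero_functorF h))
  have hYF : ¬ IsZero ((functorF n).obj Y) := fun h ↦
    hYs (FixedSize.isStalkInjective_of_isZero hY0 (FixedSize.isZero_X_of_isZero_functorF h))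
  refine (FixedSize.exists_common_summand_or_isRadicalIrreducible hXF hYF f hf).imp_left ?_
  rintro ⟨W, hW, hWX, hWY⟩
  exact ⟨W, hW, ⟨hW, hX, hX0, hWX⟩, ⟨hW, hY, hY0, hWY⟩,
    FixedSize.isEmpty_iso_of_isIrreducibleHom hX hX0 hXF f hf⟩
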